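/- Let $N\in\mathbb N$ and $\nu>0$, and let $$L_N^{(\nu-1)}(x)=\sum_{k=0}^N\binom{N+\nu-1}{N-k}\frac{(-x)^k}{k!}$$ be the classical Laguerre polynomial. It has degree $N$ and $N$ distinct zeros, all of them real and positive; let $z_1>\dots>z_N>0$ be these zeros in decreasing order. Set $r_i:=\sqrt{2z_i}$ for $i=1,\dots,N$, and let $S:=(s_{i,j})_{i,j=1,\dots,N}$ be the matrix with $$s_{i,i}:=1+\frac{2\nu}{r_i^2}+2\sum_{l\ne i}(r_i-r_l)^{-2}+2\sum_{l\ne i}(r_i+r_l)^{-2},\qquad s_{i,j}:=2(r_i+r_j)^{-2}-2(r_i-r_j)^{-2}\quad(i\ne j).$$ Then $\det S=N!\cdot 2^N$. -/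

import Mathlib

open Polynomial

/-- The classical generalized Laguerre polynomial
`L_N^{(α)}(x) = ∑_{k=0}^N binom(N+α, N-k) (-x)^k / k!` with real parameter `α`
(`Ring.choose a m = a (a-1) ⋯ (a-m+1) / m!` for real `a`). -/
noncomputable def laguerre (N : ℕ) (α : ℝ) : ℝ[X] :=
  ∑ k ∈ Finset.range (N + 1),
    C (Ring.choose ((N : ℝ) + α) (N - k) * (-1) ^ k / (Nat.factorial k : ℝ)) * X ^ k

/-- `z 0 ≥ z 1 ≥ ⋯` is the decreasing list of all real zeros of `p`, counted with multiplicity. -/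
def IsOrderedZeros {N : ℕ} (p : ℝ[X]) (z : Fin N → ℝ) : Prop :=
  Antitone z ∧ p.roots = Finset.univ.val.map z

/-- The matrix `S = (s_{i,j})` formed from `ν` and a vector `r`; `l ≠ i` is `l ∈ univ.erase i`. -/
noncomputable def matrixS {N : ℕ} (ν : ℝ) (r : Fin N → ℝ) : Matrix (Fin N) (Fin N) ℝ :=
  Matrix.of fun i j =>
    if i = j then
      1 + 2 * ν / r i ^ 2
        + 2 * ∑ l ∈ Finset.univ.erase i, ((r i - r l) ^ 2)⁻¹
        + 2 * ∑ l ∈ Finset.univ.erase i, ((r i + r l) ^ 2)⁻¹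
    else
      2 * ((r i + r j) ^ 2)⁻¹ - 2 * ((r i - r j) ^ 2)⁻¹

/-! Conjugating `S` by the diagonal matrix of the `r i` gives a matrix `A` acting on functions on
the zeros by `f ↦ 2 f(z_i) + 4 ∑_{l≠i} z_l (f(z_i) - f(z_l)) / (z_i - z_l)^2`. The Laguerre equation
at a zero gives the Stieltjes relations `2 z_i ∑_{l≠i} 1/(z_i - z_l) = z_i - ν`. They remove `ν`
from `A` and show that `A` maps `x^k` to a polynomial of degree at most `k` with top coefficient
`2(k+1)`. So `A` is triangular in the Vandermonde basis and its determinant is `∏ 2(k+1)`. Existence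
of simple positive zeros is a separate Rolle induction on `N`. -/

/-! ### Laguerre coefficients and differential identities -/

theorem Ring.choose_succ_mul (r : ℝ) (m : ℕ) :
    Ring.choose r (m + 1) * (m + 1) = Ring.choose r m * (r - m) := by
  have h := Ring.choose_smul_choose r (Nat.le_succ m)
  simp at h
  rw [← h]; ring

theorem laguerre_coeff (N : ℕ) (α : ℝ) (k : ℕ) :
    (laguerre N α).coeff k =
      if k ≤ N then Ring.choose ((N : ℝ) + α) (N - k) * (-1) ^ k / (Nat.factorial k : ℝ)
      else 0 := by
  simp [laguerre, coeff_C_mul, coeff_X_pow]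

theorem laguerre_natDegree_le (N : ℕ) (α : ℝ) : (laguerre N α).natDegree ≤ N := by
  rw [natDegree_le_iff_coeff_eq_zero]
  intro k hk
  rw [laguerre_coeff, if_neg (by lia)]

theorem laguerre_coeff_self (N : ℕ) (α : ℝ) :
    (laguerre N α).coeff N = (-1) ^ N / (Nat.factorial N : ℝ) := by
  simp [laguerre_coeff]

theorem laguerre_natDegree (N : ℕ) (α : ℝ) : (laguerre N α).natDegree = N := by
  apply natDegree_eq_of_le_of_coeff_ne_zero (laguerre_natDegree_le N α)
  rw [laguerre_coeff_self]
  positivity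

theorem laguerre_coeff_succ (N : ℕ) (α : ℝ) (k : ℕ) :
    (k + 1) * (k + α + 1) * (laguerre N α).coeff (k + 1) =
      (k - N) * (laguerre N α).coeff k := by
  rw [laguerre_coeff, laguerre_coeff]
  rcases lt_trichotomy k N with h | rfl | h
  · obtain ⟨m, rfl⟩ : ∃ m, N = k + 1 + m := ⟨N - (k + 1), by lia⟩
    rw [if_pos (by lia), if_pos (by lia), show k + 1 + m - (k + 1) = m by lia,
      show k + 1 + m - k = m + 1 by lia]
    have h := Ring.choose_succ_mul (((k + 1 + m : ℕ) : ℝ) + α) m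
    have hk : (Nat.factorial k : ℝ) ≠ 0 := by positivity
    rw [Nat.factorial_succ]
    push_cast at h ⊢
    field_simp
    rw [pow_succ]
    linear_combination (-1) ^ k * h
  · simp
  · rw [if_neg (by lia), if_neg (by lia)]; simp

theorem laguerre_ode (N : ℕ) (α : ℝ) :
    X * derivative (derivative (laguerre N α)) + (C (α + 1) - X) * derivative (laguerre N α)
      + C (N : ℝ) * laguerre N α = 0 := by
  ext k
  have h := laguerre_coeff_succ N α k
  rcases k with _ | k
  · simp [sub_mul, coeff_derivative, mul_coeff_zero] at h ⊢
    linarith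
  · simp [sub_mul, coeff_derivative, -map_add, coeff_C_mul, coeff_X_mul] at h ⊢
    linear_combination h

/-- Raises the degree while lowering `α`; this is the induction step for the zeros. -/
theorem succ_mul_laguerre_succ (N : ℕ) (α : ℝ) :
    C ((N : ℝ) + 1) * laguerre (N + 1) α =
      X * derivative (laguerre N (α + 1)) + (C (α + 1) - X) * laguerre N (α + 1) := by
  have key : ∀ k ≤ N, Ring.choose ((N : ℝ) + (α + 1)) (N + 1 - k) * (N + 1 - k) =
      Ring.choose ((N : ℝ) + (α + 1)) (N - k) * (k + α + 1) := by
    intro k hk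
    obtain ⟨m, rfl⟩ : ∃ m, N = k + m := ⟨N - k, by lia⟩
    rw [show k + m + 1 - k = m + 1 by lia, show k + m - k = m by lia]
    have h := Ring.choose_succ_mul (((k + m : ℕ) : ℝ) + (α + 1)) m
    push_cast at h ⊢
    linear_combination h
  have e : ((N + 1 : ℕ) : ℝ) + α = (N : ℝ) + (α + 1) := by push_cast; ring
  ext k
  rcases k with _ | k
  · have := key 0 (by lia)
    simp [sub_mul, mul_coeff_zero, laguerre_coeff] at this ⊢
    rw [show (N : ℝ) + 1 + α = N + (α + 1) by ring]
    linear_combination this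
  · simp only [sub_mul, coeff_C_mul, coeff_X_mul, coeff_add, coeff_sub,
      coeff_derivative, laguerre_coeff, e]
    have hk : (Nat.factorial k : ℝ) ≠ 0 := by positivity
    rcases lt_trichotomy k N with h | rfl | h
    · have := key (k + 1) h
      rw [if_pos (by lia), if_pos (by lia), if_pos (by lia)]
      rw [Nat.factorial_succ]
      rw [show N + 1 - (k + 1) = N - k by lia] at this ⊢
      push_cast at this ⊢
      field_simp
      rw [pow_succ]
      linear_combination - (-1) ^ k * this
    · simp [Nat.factorial_succ]
      field_simp
      ring
    · rw [if_neg (by lia), if_neg (by lia), if_neg (by lia)]; simp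

/-! ### Simple positive zeros by Rolle -/

/-- If `p` has only simple positive zeros, then so has `X * p' + (c - X) * p`, which has one more:
it is up to a positive factor the derivative of `x ^ c * exp (-x) * p x`. -/
theorem exists_card_roots_X_mul_derivative_add {p : ℝ[X]} {c : ℝ} (hc : 0 < c)
    (hl : 0 < p.leadingCoeff) (s : Finset ℝ) (hcard : s.card = p.natDegree)
    (hs : ∀ x ∈ s, 0 < x ∧ p.eval x = 0) :
    ∃ t : Finset ℝ, t.card = s.card + 1 ∧
      ∀ x ∈ t, 0 < x ∧ (X * derivative p + (C c - X) * p).eval x = 0 := by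
  set q : ℝ[X] := X * derivative p + (C c - X) * p with hq
  have hdeg : q.natDegree ≤ p.natDegree + 1 := by
    have := natDegree_derivative_le p
    rw [hq]; compute_degree; lia
  have hcoeff : q.coeff (p.natDegree + 1) = -p.leadingCoeff := by
    simp [hq, sub_mul, coeff_derivative]
  have hnat : q.natDegree = p.natDegree + 1 :=
    natDegree_eq_of_le_of_coeff_ne_zero hdeg (by rw [hcoeff]; exact (neg_neg_of_pos hl).ne)
  have hlq : q.leadingCoeff < 0 := by
    rw [leadingCoeff, hnat, hcoeff]; linarith
  have hq0 : q ≠ 0 := by rintro h; simp [h] at hlq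
  have hqbot : Filter.Tendsto (fun x => eval x q) .atTop .atBot :=
    q.tendsto_atBot_of_leadingCoeff_nonpos (natDegree_pos_iff_degree_pos.1 (by lia)) hlq.le
  set f : ℝ → ℝ := fun x => x ^ c * (Real.exp (-x) * p.eval x) with hf
  have hderiv : ∀ x, 0 < x → HasDerivAt f (x ^ (c - 1) * Real.exp (-x) * q.eval x) x := by
    intro x hx
    have h1 := Real.hasDerivAt_rpow_const (x := x) (p := c) (Or.inl hx.ne')
    have h2 := (hasDerivAt_neg x).exp
    refine (h1.mul (h2.mul (p.hasDerivAt x))).congr_deriv ?_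
    have : x ^ c = x ^ (c - 1) * x := by
      rw [Real.rpow_sub_one hx.ne']; field_simp
    simp [hq, this]
    ring
  have hcont : Continuous f := by
    refine (Real.continuous_rpow_const hc.le).mul ?_
    fun_prop
  -- Since `c > 0`, `f` also vanishes at `0`, which gives one more Rolle interval.
  set s' : Finset ℝ := insert 0 s with hs'
  have hs'0 : ∀ x ∈ s', 0 ≤ x := by
    intro x hx
    rcases Finset.mem_insert.1 hx with rfl | h
    exacts [le_rfl, (hs x h).1.le]
  have hfs : ∀ x ∈ s', f x = 0 := by
    intro x hx
    rcases Finset.mem_insert.1 hx with rfl | h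
    · simp [hf, Real.zero_rpow hc.ne']
    · simp [hf, (hs x h).2]
  have hcard' : s'.card = s.card + 1 :=
    Finset.card_insert_of_notMem fun h => (hs 0 h).1.false
  have hne : s'.Nonempty := ⟨0, by simp [hs']⟩
  set M := s'.max' hne with hM
  have hM0 : 0 ≤ M := hs'0 _ (s'.max'_mem hne)
  -- Beyond `M`, `f` first increases, so `q > 0` somewhere, while `q → -∞`; hence `q` has a further
  -- zero `w > M`.
  obtain ⟨x₀, hx₀, hp₀⟩ : ∃ x₀, M < x₀ ∧ 0 < p.eval x₀ := by
    rcases Nat.eq_zero_or_pos p.natDegree with h0 | h0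
    · refine ⟨M + 1, by linarith, ?_⟩
      rw [eq_C_of_natDegree_eq_zero h0, eval_C]
      rwa [leadingCoeff, h0] at hl
    · have := p.tendsto_atTop_of_leadingCoeff_nonneg (natDegree_pos_iff_degree_pos.1 h0) hl.le
      exact ((Filter.eventually_gt_atTop M).and (this.eventually_gt_atTop 0)).exists
  obtain ⟨ξ, hξ, hξq⟩ := exists_hasDerivAt_eq_slope f
    (fun x => x ^ (c - 1) * Real.exp (-x) * q.eval x) hx₀ hcont.continuousOn
    (fun x hx => hderiv x (hM0.trans_lt hx.1))
  have hξ0 : 0 < ξ := hM0.trans_lt hξ.1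
  have hqξ : 0 < q.eval ξ := by
    have h1 : 0 < (f x₀ - f M) / (x₀ - M) := by
      rw [hfs M (s'.max'_mem hne), sub_zero]
      have : 0 < x₀ := hM0.trans_lt hx₀
      exact div_pos (by positivity) (by linarith)
    rw [← hξq] at h1
    exact pos_of_mul_pos_right h1 (by positivity)
  obtain ⟨y, hy, hyq⟩ := ((Filter.eventually_gt_atTop ξ).and (hqbot.eventually_lt_atBot 0)).exists
  obtain ⟨w, hw, hwq⟩ := intermediate_value_Icc' hy.le q.continuous.continuousOn
    (show (0 : ℝ) ∈ Set.Icc _ _ from ⟨hyq.le, hqξ.le⟩)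
  have hMw : M < w := hξ.1.trans_le hw.1
  have hw0 : 0 < w := hM0.trans_lt hMw
  set t : Finset ℝ := q.roots.toFinset.filter (fun x => 0 < x) with ht
  have hmem : ∀ x, x ∈ t ↔ q.eval x = 0 ∧ 0 < x := by
    intro x; simp [ht, hq0]
  have hle : (insert w s').card ≤ t.card + 1 := by
    have hinter : s'.card ≤ (t.erase w).card + 1 := by
      apply Finset.card_le_of_interleaved
      intro x hx y hy hxy _
      obtain ⟨z, hz, hz0⟩ := exists_hasDerivAt_eq_zero hxy hcont.continuousOn
        ((hfs x hx).trans (hfs y hy).symm) (fun u hu => hderiv u ((hs'0 x hx).trans_lt hu.1))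
      have hzpos := (hs'0 x hx).trans_lt hz.1
      refine ⟨z, Finset.mem_erase.2 ⟨?_, (hmem z).2 ⟨?_, hzpos⟩⟩, hz⟩
      · have := s'.le_max' y hy
        exact ((hz.2.trans_le this).trans hMw).ne
      · have : z ^ (c - 1) * Real.exp (-z) ≠ 0 := by positivity
        exact (mul_eq_zero.1 hz0).resolve_left this
    have h1 := Finset.card_erase_add_one ((hmem w).2 ⟨hwq, hw0⟩)
    have h2 := Finset.card_insert_le w s'
    lia
  have hnot : w ∉ s' := fun h => (s'.le_max' w h).not_gt hMw
  rw [Finset.card_insert_of_notMem hnot] at hle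
  obtain ⟨u, hu, hucard⟩ := Finset.exists_subset_card_eq (s := t) (n := s.card + 1) (by lia)
  exact ⟨u, hucard, fun x hx => ((hmem x).1 (hu hx)).symm⟩

theorem laguerre_exists_finset_roots (N : ℕ) :
    ∀ α : ℝ, -1 < α → ∃ s : Finset ℝ, s.card = N ∧
      ∀ x ∈ s, 0 < x ∧ (laguerre N α).eval x = 0 := by
  induction N with
  | zero => exact fun α _ => ⟨∅, by simp⟩
  | succ N ih =>
    intro α hα
    obtain ⟨s, hcard, hs⟩ := ih (α + 1) (by linarith)
    have hsign : ((-1 : ℝ) ^ N) ≠ 0 := by positivity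
    -- The sign makes the leading coefficient positive.
    set p : ℝ[X] := C ((-1) ^ N) * laguerre N (α + 1) with hp
    have hdeg : p.natDegree = N := by rw [hp, natDegree_C_mul hsign, laguerre_natDegree]
    obtain ⟨t, ht, hroot⟩ := exists_card_roots_X_mul_derivative_add (p := p) (c := α + 1)
      (by linarith)
      (by
        rw [leadingCoeff, hdeg, hp, coeff_C_mul, laguerre_coeff_self, mul_div_assoc', ← mul_pow]
        norm_num
        positivity)
      s (hcard.trans hdeg.symm) (fun x hx => ⟨(hs x hx).1, by simp [hp, (hs x hx).2]⟩)
    refine ⟨t, by lia, fun x hx => ⟨(hroot x hx).1, ?_⟩⟩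
    have e : X * derivative p + (C (α + 1) - X) * p =
        C ((-1) ^ N * ((N : ℝ) + 1)) * laguerre (N + 1) α := by
      rw [C_mul, mul_assoc, succ_mul_laguerre_succ, hp, derivative_C_mul]
      ring
    have h := (hroot x hx).2
    rw [e, eval_mul, eval_C] at h
    exact (mul_eq_zero.1 h).resolve_left (by positivity)

theorem laguerre_exists_isOrderedZeros (N : ℕ) {α : ℝ} (hα : -1 < α) :
    ∃ z : Fin N → ℝ, IsOrderedZeros (laguerre N α) z ∧ StrictAnti z ∧ ∀ i, 0 < z i := by
  obtain ⟨s, hcard, hs⟩ := laguerre_exists_finset_roots N α hα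
  have h0 : laguerre N α ≠ 0 := by
    intro h
    have := laguerre_coeff_self N α
    rw [h, coeff_zero] at this
    exact absurd this.symm (by positivity)
  have hroots : s.val = (laguerre N α).roots := by
    apply Multiset.eq_of_le_of_card_le
    · rw [Multiset.le_iff_subset s.nodup]
      intro x hx
      exact (mem_roots h0).2 (hs x hx).2
    · exact (card_roots' _).trans (by rw [laguerre_natDegree]; exact hcard.ge)
  have hanti : StrictAnti fun i : Fin N => s.orderEmbOfFin hcard i.rev := by
    intro i j hij
    simpa using hij
  refine ⟨_, ⟨hanti.antitone, ?_⟩, hanti, fun i => (hs _ (s.orderEmbOfFin_mem hcard _)).1⟩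
  have himg : Finset.univ.image (fun i : Fin N => s.orderEmbOfFin hcard i.rev) = s := by
    apply Finset.eq_of_subset_of_card_le
    · intro x hx
      obtain ⟨i, -, rfl⟩ := Finset.mem_image.1 hx
      exact s.orderEmbOfFin_mem hcard _
    · rw [Finset.card_image_of_injective _ hanti.injective]; simp [hcard]
  rw [← hroots, ← Finset.image_val_of_injOn hanti.injective.injOn, himg]

/-! ### Stieltjes relations and power sums -/

/-- With `p = (X - z_i) g`, at `z_i` one has `p' = g` and `p'' = 2 g'`; the sum is the logarithmic
derivative of `g`. -/
theorem sum_inv_sub_mul_eval_derivative {ι : Type*} [Fintype ι] [DecidableEq ι] {p : ℝ[X]}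
    {z : ι → ℝ} (hz : Function.Injective z) (hp : p ≠ 0)
    (hprod : p = C p.leadingCoeff * ∏ i, (X - C (z i))) (i : ι) :
    (derivative p).eval (z i) ≠ 0 ∧
    (derivative (derivative p)).eval (z i) =
      2 * (∑ l ∈ Finset.univ.erase i, (z i - z l)⁻¹) * (derivative p).eval (z i) := by
  set g : ℝ[X] := C p.leadingCoeff * ∏ l ∈ Finset.univ.erase i, (X - C (z l)) with hg
  have hpg : p = (X - C (z i)) * g := by
    rw [hg, mul_left_comm, Finset.mul_prod_erase _ (fun l => X - C (z l)) (Finset.mem_univ i)]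
    exact hprod
  have hne : ∀ l ∈ Finset.univ.erase i, z i - z l ≠ 0 := fun l hl =>
    sub_ne_zero.2 fun h => (Finset.ne_of_mem_erase hl) (hz h).symm
  have hgev : g.eval (z i) = p.leadingCoeff * ∏ l ∈ Finset.univ.erase i, (z i - z l) := by
    simp [hg, eval_prod]
  have h1 : (derivative p).eval (z i) = g.eval (z i) := by rw [hpg]; simp
  have h2 : (derivative (derivative p)).eval (z i) = 2 * (derivative g).eval (z i) := by
    rw [hpg]; simp; ring
  refine ⟨?_, ?_⟩
  · rw [h1, hgev]
    exact mul_ne_zero (leadingCoeff_ne_zero.2 hp) (Finset.prod_ne_zero_iff.2 hne)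
  · rw [h2, h1, hgev, hg, derivative_C_mul, derivative_prod_finset]
    simp only [eval_mul, eval_C, eval_finsetSum, eval_prod, eval_sub, eval_X, derivative_sub,
      derivative_X, derivative_C, sub_zero, mul_one]
    rw [mul_assoc, mul_left_comm (∑ l ∈ _, _)]
    congr 2
    rw [Finset.sum_mul]
    refine Finset.sum_congr rfl fun l hl => ?_
    rw [← Finset.mul_prod_erase _ _ hl, inv_mul_cancel_left₀ (hne l hl)]

theorem laguerre_sum_inv_sub {N : ℕ} {ν : ℝ} {z : Fin N → ℝ}
    (hroots : (laguerre N (ν - 1)).roots = Finset.univ.val.map z)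
    (hz : Function.Injective z) (i : Fin N) :
    2 * z i * ∑ l ∈ Finset.univ.erase i, (z i - z l)⁻¹ = z i - ν := by
  set p := laguerre N (ν - 1) with hp
  have h0 : p ≠ 0 := by
    rintro h
    have : z i ∈ p.roots := by rw [hroots]; simp
    simp [h] at this
  have hprod : p = C p.leadingCoeff * ∏ i, (X - C (z i)) := by
    have := C_leadingCoeff_mul_prod_multiset_X_sub_C (p := p)
      (by rw [hroots, hp, laguerre_natDegree]; simp)
    rw [hroots, Multiset.map_map] at this
    exact this.symm
  obtain ⟨h1, h2⟩ := sum_inv_sub_mul_eval_derivative hz h0 hprod i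
  have hode := congrArg (eval (z i)) (laguerre_ode N (ν - 1))
  have hroot : p.eval (z i) = 0 := (mem_roots h0).1 (by rw [hroots]; simp)
  rw [← hp] at hode
  simp only [eval_add, eval_mul, eval_sub, eval_X, eval_C, eval_zero, hroot, h2] at hode
  apply mul_right_cancel₀ h1
  linear_combination hode

/-- The power sums `∑_{l ≠ i} z l ^ (k + 1) / (z i - z l)` are polynomials in `z i`. -/
theorem exists_polynomial_sum_pow_div {N : ℕ} {ν : ℝ} {z : Fin N → ℝ}
    (hz : Function.Injective z)
    (hsum : ∀ i, 2 * z i * ∑ l ∈ Finset.univ.erase i, (z i - z l)⁻¹ = z i - ν) (k : ℕ) :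
    ∃ R : ℝ[X], R.natDegree ≤ k + 1 ∧ R.coeff (k + 1) = 1 / 2 ∧
      ∀ i, R.eval (z i) = ∑ l ∈ Finset.univ.erase i, z l ^ (k + 1) * (z i - z l)⁻¹ := by
  have hne : ∀ i, ∀ l ∈ Finset.univ.erase i, z i - z l ≠ 0 := fun i l hl =>
    sub_ne_zero.2 fun h => (Finset.ne_of_mem_erase hl) (hz h).symm
  -- Write one factor `z l` as `z i - (z i - z l)`.
  have hstep : ∀ k i, ∑ l ∈ Finset.univ.erase i, z l ^ (k + 1) * (z i - z l)⁻¹ =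
      z i * (∑ l ∈ Finset.univ.erase i, z l ^ k * (z i - z l)⁻¹)
        - ((∑ l, z l ^ k) - z i ^ k) := by
    intro k i
    rw [← Finset.sum_erase_eq_sub (Finset.mem_univ i), Finset.mul_sum, ← Finset.sum_sub_distrib]
    refine Finset.sum_congr rfl fun l hl => ?_
    have := hne i l hl
    field_simp
    ring
  induction k with
  | zero =>
    refine ⟨C (1 / 2) * X - C (ν / 2 + N - 1), by compute_degree, ?_, fun i => ?_⟩
    · simp [-map_add, -map_sub, coeff_C]
    · rw [hstep]
      simp only [pow_zero, one_mul, Finset.sum_const, Finset.card_univ, Fintype.card_fin,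
        nsmul_eq_mul, mul_one, eval_sub, eval_mul, eval_C, eval_X]
      linear_combination (-1 / 2) * hsum i
  | succ k ih =>
    obtain ⟨R, hdeg, hcoeff, hR⟩ := ih
    refine ⟨X * R - C (∑ l, z l ^ (k + 1)) + X ^ (k + 1), ?_, ?_, fun i => ?_⟩
    · compute_degree!
      lia
    · simp [hcoeff, coeff_X_pow, -map_sum, -map_pow]
    · rw [hstep, ← hR]
      simp [-map_sum, -map_pow]
      ring

theorem exists_polynomial_sum_sub_pow_div {N : ℕ} {ν : ℝ} {z : Fin N → ℝ}
    (hz : Function.Injective z)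
    (hsum : ∀ i, 2 * z i * ∑ l ∈ Finset.univ.erase i, (z i - z l)⁻¹ = z i - ν) (k : ℕ) :
    ∃ T : ℝ[X], T.natDegree ≤ k ∧ T.coeff k = k / 2 ∧ ∀ i, T.eval (z i) =
      ∑ l ∈ Finset.univ.erase i, z l * (z i ^ k - z l ^ k) * ((z i - z l) ^ 2)⁻¹ := by
  have hne : ∀ i, ∀ l ∈ Finset.univ.erase i, z i - z l ≠ 0 := fun i l hl =>
    sub_ne_zero.2 fun h => (Finset.ne_of_mem_erase hl) (hz h).symm
  induction k with
  | zero => exact ⟨0, by simp⟩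
  | succ k ih =>
    obtain ⟨T, hTdeg, hTcoeff, hT⟩ := ih
    obtain ⟨R, hRdeg, hRcoeff, hR⟩ := exists_polynomial_sum_pow_div hz hsum k
    -- From `a^(k+1) - b^(k+1) = a (a^k - b^k) + b^k (a - b)`; each step adds `1/2` to the top
    -- coefficient.
    refine ⟨X * T + R, ?_, ?_, fun i => ?_⟩
    · compute_degree!
      lia
    · simp [hTcoeff, hRcoeff]; ring
    · simp only [eval_add, eval_mul, eval_X, hT, hR, Finset.mul_sum, ← Finset.sum_add_distrib]
      refine Finset.sum_congr rfl fun l hl => ?_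
      have := hne i l hl
      field_simp
      ring

/-! ### The determinant -/

/-- A matrix which acts on the Vandermonde basis of functions on the nodes `z` by a triangular
matrix has the product of the diagonal entries of that matrix as its determinant. -/
theorem det_eq_prod_of_mul_vandermonde {N : ℕ} {z : Fin N → ℝ} (hz : Function.Injective z)
    (A : Matrix (Fin N) (Fin N) ℝ) (Q : Fin N → ℝ[X])
    (hdeg : ∀ k, (Q k).natDegree ≤ k)
    (hQ : ∀ i k, (A * Matrix.vandermonde z) i k = (Q k).eval (z i)) :
    A.det = ∏ k, (Q k).coeff k := by
  set U : Matrix (Fin N) (Fin N) ℝ := Matrix.of fun j k => (Q k).coeff j with hU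
  have hmul : A * Matrix.vandermonde z = Matrix.vandermonde z * U := by
    ext i k
    rw [hQ, eval_eq_sum_range' ((hdeg k).trans_lt k.2), Matrix.mul_apply,
      ← Fin.sum_univ_eq_sum_range (fun j => (Q k).coeff j * z i ^ j)]
    simp [hU, Matrix.vandermonde_apply, mul_comm]
  have hUdet : U.det = ∏ k, (Q k).coeff k := by
    rw [Matrix.det_of_isUpperTriangular]
    · simp [hU]
    · intro j k hjk
      exact coeff_eq_zero_of_natDegree_lt ((hdeg k).trans_lt hjk)
  have h := congrArg Matrix.det hmul
  rw [Matrix.det_mul, Matrix.det_mul, mul_comm, hUdet] at h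
  exact mul_left_cancel₀ (Matrix.det_vandermonde_ne_zero_iff.2 hz) h

theorem matrixS_mul_diagonal_apply {N : ℕ} {ν : ℝ} {z : Fin N → ℝ}
    (hz : Function.Injective z) (hpos : ∀ i, 0 < z i)
    (hsum : ∀ i, 2 * z i * ∑ l ∈ Finset.univ.erase i, (z i - z l)⁻¹ = z i - ν) (i j : Fin N) :
    matrixS ν (fun i => Real.sqrt (2 * z i)) i j * Real.sqrt (2 * z j) =
      Real.sqrt (2 * z i) *
        if i = j then 2 + 4 * ∑ l ∈ Finset.univ.erase i, z l * ((z i - z l) ^ 2)⁻¹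
        else -4 * z j * ((z i - z j) ^ 2)⁻¹ := by
  set r : Fin N → ℝ := fun i => Real.sqrt (2 * z i) with hr
  have hrpos : ∀ i, 0 < r i := fun i => Real.sqrt_pos.2 (by linarith [hpos i])
  have hzr : ∀ i, z i = r i ^ 2 / 2 := by
    intro i
    rw [hr, Real.sq_sqrt (by linarith [hpos i])]; ring
  have hsub : ∀ i l, l ≠ i → r i - r l ≠ 0 := by
    intro i l hl h
    apply hl
    apply hz
    rw [hzr, hzr, sub_eq_zero.1 h]
  have hadd : ∀ i l, r i + r l ≠ 0 := fun i l => (add_pos (hrpos i) (hrpos l)).ne'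
  have hzsub : ∀ i l, z i - z l = (r i - r l) * (r i + r l) / 2 := by
    intro i l; rw [hzr, hzr]; ring
  change matrixS ν r i j * r j = r i * _
  rw [matrixS, Matrix.of_apply]
  split_ifs with hij
  · subst hij
    rw [mul_comm]
    congr 1
    have hν : 2 * ν / r i ^ 2 = 1 - 2 * ∑ l ∈ Finset.univ.erase i, (z i - z l)⁻¹ := by
      have h1 : r i ^ 2 = 2 * z i := by rw [hzr]; ring
      have h2 := hsum i
      have h3 := (hpos i).ne'
      rw [h1, div_eq_iff (by positivity)]
      linear_combination 2 * h2
    rw [hν]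
    -- Termwise, both sides are `2 (z_i + z_l) / (z_i - z_l)^2`.
    have key : 2 * ∑ l ∈ Finset.univ.erase i, ((r i - r l) ^ 2)⁻¹
        + 2 * ∑ l ∈ Finset.univ.erase i, ((r i + r l) ^ 2)⁻¹ =
        2 * ∑ l ∈ Finset.univ.erase i, (z i - z l)⁻¹
        + 4 * ∑ l ∈ Finset.univ.erase i, z l * ((z i - z l) ^ 2)⁻¹ := by
      simp only [Finset.mul_sum, ← Finset.sum_add_distrib]
      refine Finset.sum_congr rfl fun l hl => ?_
      have h1 := hsub i l (Finset.ne_of_mem_erase hl)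
      have h2 := hadd i l
      rw [hzsub, hzr l]
      field_simp
      ring
    linear_combination key
  · have h1 := hsub i j (Ne.symm hij)
    have h2 := hadd i j
    rw [hzsub, hzr j]
    field_simp
    ring

theorem det_matrixS {N : ℕ} {ν : ℝ} {z : Fin N → ℝ}
    (hz : Function.Injective z) (hpos : ∀ i, 0 < z i)
    (hsum : ∀ i, 2 * z i * ∑ l ∈ Finset.univ.erase i, (z i - z l)⁻¹ = z i - ν) :
    (matrixS ν (fun i => Real.sqrt (2 * z i))).det = (Nat.factorial N : ℝ) * 2 ^ N := by
  set r : Fin N → ℝ := fun i => Real.sqrt (2 * z i) with hr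
  set A : Matrix (Fin N) (Fin N) ℝ := Matrix.of fun i j =>
    if i = j then 2 + 4 * ∑ l ∈ Finset.univ.erase i, z l * ((z i - z l) ^ 2)⁻¹
    else -4 * z j * ((z i - z j) ^ 2)⁻¹ with hA
  have hconj : matrixS ν r * Matrix.diagonal r = Matrix.diagonal r * A := by
    ext i j
    rw [Matrix.mul_diagonal, Matrix.diagonal_mul]
    exact matrixS_mul_diagonal_apply hz hpos hsum i j
  have hdet : (matrixS ν r).det = A.det := by
    have h := congrArg Matrix.det hconj
    rw [Matrix.det_mul, Matrix.det_mul, mul_comm] at h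
    refine mul_left_cancel₀ ?_ h
    rw [Matrix.det_diagonal]
    exact Finset.prod_ne_zero_iff.2 fun i _ => (Real.sqrt_pos.2 (by linarith [hpos i])).ne'
  choose T hTdeg hTcoeff hT using exists_polynomial_sum_sub_pow_div hz hsum
  rw [hdet, det_eq_prod_of_mul_vandermonde hz A (fun k => C 2 * X ^ (k : ℕ) + C 4 * T k)]
  · have : ∀ k : Fin N, (C 2 * X ^ (k : ℕ) + C 4 * T k).coeff k = (2 : ℝ) * ((k : ℕ) + 1) := by
      intro k
      rw [coeff_add, coeff_C_mul, coeff_C_mul, hTcoeff, coeff_X_pow_self]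
      ring
    simp only [this]
    rw [Finset.prod_mul_distrib, Finset.prod_const, Finset.card_univ, Fintype.card_fin, mul_comm,
      Fin.prod_univ_eq_prod_range (fun k => (k : ℝ) + 1), ← Finset.prod_range_add_one_eq_factorial]
    push_cast
    rfl
  · intro k
    have := hTdeg k
    compute_degree!
  · intro i k
    rw [Matrix.mul_apply, ← Finset.add_sum_erase _ _ (Finset.mem_univ i)]
    have : ∑ l ∈ Finset.univ.erase i, A i l * Matrix.vandermonde z l k =
        ∑ l ∈ Finset.univ.erase i, -4 * z l * ((z i - z l) ^ 2)⁻¹ * z l ^ (k : ℕ) :=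
      Finset.sum_congr rfl fun l hl => by
        simp [hA, Matrix.vandermonde_apply, (Finset.ne_of_mem_erase hl).symm]
    rw [this]
    simp only [hA, Matrix.of_apply, if_true, Matrix.vandermonde_apply, eval_add, eval_mul, eval_C,
      eval_pow, eval_X, hT]
    rw [add_mul, add_assoc, Finset.mul_sum, Finset.sum_mul, ← Finset.sum_add_distrib,
      Finset.mul_sum]
    congr 1
    refine Finset.sum_congr rfl fun l _ => ?_
    ring

theorem corollary3p4 (N : ℕ) (ν : ℝ) (hν : 0 < ν) :
    (laguerre N (ν - 1)).natDegree = N ∧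
    (∃ z : Fin N → ℝ, IsOrderedZeros (laguerre N (ν - 1)) z ∧ StrictAnti z ∧ ∀ i, 0 < z i) ∧
    ∀ z : Fin N → ℝ, IsOrderedZeros (laguerre N (ν - 1)) z →
      (matrixS ν (fun i => Real.sqrt (2 * z i))).det = (Nat.factorial N : ℝ) * 2 ^ N := by
  have hex := laguerre_exists_isOrderedZeros N (α := ν - 1) (by linarith)
  refine ⟨laguerre_natDegree _ _, hex, ?_⟩
  rintro z ⟨-, hroots⟩
  obtain ⟨y, ⟨-, hy⟩, hanti, hpos⟩ := hex
  -- `z` is only weakly ordered; simplicity and positivity come from `y`, which lists the same root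
  -- multiset.
  have hnodup : (Finset.univ.val.map z).Nodup := by
    rw [← hroots, hy]
    exact Finset.univ.nodup.map hanti.injective
  have hz : Function.Injective z := fun i j h =>
    Multiset.inj_on_of_nodup_map hnodup i (Finset.mem_univ i) j (Finset.mem_univ j) h
  refine det_matrixS hz (fun i => ?_) (laguerre_sum_inv_sub hroots hz)
  have : z i ∈ Finset.univ.val.map y := by
    rw [← hy, hroots]
    exact Multiset.mem_map_of_mem z (Finset.mem_univ i)
  obtain ⟨j, -, hj⟩ := Multiset.mem_map.1 this
  exact hj ▸ hpos j
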